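/- Let $p\ge 3$ and $m_b\ge 1$ be integers with $2(m_b-1)\le p+1$ (this holds in particular whenever $m_b\le p/2$). Let $A_b\in\mathbb R^{m_b\times p}$ be fully linearly independent, meaning that any $m_b$ of its columns are linearly independent. Consider the channel whose input is a random vector $\mathbf X\in\{0,1\}^p$ and whose output is $\mathbf Y=A_b\,\mathrm{diag}(W_1,\dots,W_p)\,\mathbf X$, where $W_1,\dots,W_p$ are i.i.d. $\mathcal N(0,1)$ and independent of $\mathbf X$. For $0\le k\le p$ let $\mathcal X_k^p$ be the set of vectors in $\{0,1\}^p$ with exactly $k$ ones, let $A_b(i)$ be the $i$-th column of $A_b$, and for $\mathbf x\in\{0,1\}^p$ let $A_b(\mathbf x)$ be the submatrix of $A_b$ formed by the columns $i$ with $x_i=1$. Then the maximum of the mutual information $I(\mathbf X;\mathbf Y)$ over all distributions of $\mathbf X$ on $\{0,1\}^p$ exists, is finite, and satisfies $$\max_{\mathbf X} I(\mathbf X;\mathbf Y)\;\le\;\max\Big(\log\tbinom{p}{m_b-1},\ \max_{m_b\le k\le p}\tilde c(k)\Big)+\log p,$$ where $$\tilde c(k)=\max_{1\le i\le p}\frac{m_b}{2}\log\Big(2\pi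 e\,\frac{k}{m_b}\,\|A_b(i)\|^2\Big)-\min_{\mathbf x\in\mathcal X_k^p}\frac12\log\Big((2\pi e)^{m_b}\det\big(A_b(\mathbf x)A_b(\mathbf x)^T\big)\Big).$$ Mutual information and all logarithms are taken in the same base (natural logarithms, say). -/

import Mathlib

open MeasureTheory ProbabilityTheory

noncomputable section

namespace SparseChannel

/-- Mutual information `I(X;Y)` (in nats) of two random variables on the same probability space:
the Kullback-Leibler divergence of the joint law from the product of the marginal laws. -/
def mutualInfo {Ω α β : Type*} [MeasurableSpace Ω] [MeasurableSpace α] [MeasurableSpace β]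
    (X : Ω → α) (Y : Ω → β) (μ : Measure Ω) : ENNReal :=
  InformationTheory.klDiv (μ.map (fun ω => (X ω, Y ω))) ((μ.map X).prod (μ.map Y))

variable {m p : ℕ}

/-- The weight (number of ones) of a binary vector. -/
def weight (x : Fin p → Bool) : ℕ := (Finset.univ.filter (fun i => x i = true)).card

/-- `X_k^p`: the binary vectors of length `p` with exactly `k` ones. -/
def weightClass (p k : ℕ) : Set (Fin p → Bool) := {x | weight x = k}

/-- `A(x)`: the submatrix of `A` formed by the columns `i` with `x i = 1`. -/
def colsAt (A : Matrix (Fin m) (Fin p) ℝ) (x : Fin p → Bool) :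
    Matrix (Fin m) {i : Fin p // x i = true} ℝ :=
  A.submatrix id Subtype.val

/-- `A` is fully linearly independent: any collection of at most `m` of its columns is linearly
independent (for `m ≤ p`: any `m` of its columns are linearly independent). -/
def FullyLinearlyIndependent (A : Matrix (Fin m) (Fin p) ℝ) : Prop :=
  ∀ s : Finset (Fin p), s.card ≤ m → LinearIndependent ℝ (fun i : s => A.col (i : Fin p))

/-- The squared Euclidean norm of the `i`-th column of `A`. -/
def colNormSq (A : Matrix (Fin m) (Fin p) ℝ) (i : Fin p) : ℝ := ∑ j, A j i ^ 2

/-- The channel output `Y = A diag(w) x`. -/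
def output (A : Matrix (Fin m) (Fin p) ℝ) (x : Fin p → Bool) (w : Fin p → ℝ) : Fin m → ℝ :=
  A.mulVec (fun i => if x i = true then w i else 0)

/-- The law of `W = (W_1, …, W_p)` with i.i.d. standard Gaussian entries. -/
def multiplierLaw (p : ℕ) : Measure (Fin p → ℝ) := Measure.pi (fun _ => gaussianReal 0 1)

/-- `I(X;Y)` for the input `X` with distribution `P`, the independent Gaussian vector `W`, and
`Y = A diag(W) X`. -/
def channelInfo (A : Matrix (Fin m) (Fin p) ℝ) (P : PMF (Fin p → Bool)) : ENNReal :=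
  mutualInfo (fun ω : (Fin p → Bool) × (Fin p → ℝ) => ω.1) (fun ω => output A ω.1 ω.2)
    (P.toMeasure.prod (multiplierLaw p))

/-- `c̃(k)`. The supremum and the infimum range over finite sets, nonempty for `1 ≤ p`, `k ≤ p`. -/
def cTilde (A : Matrix (Fin m) (Fin p) ℝ) (k : ℕ) : ℝ :=
  (⨆ i : Fin p, (m : ℝ) / 2 *
      Real.log (2 * Real.pi * Real.exp 1 * ((k : ℝ) / (m : ℝ)) * colNormSq A i))
    - ⨅ x : weightClass p k, 1 / 2 *
      Real.log ((2 * Real.pi * Real.exp 1) ^ m *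
        (colsAt A (x : Fin p → Bool) * (colsAt A (x : Fin p → Bool)).transpose).det)

end SparseChannel

end

/-! For any reference law `ν`, the mutual information is the average divergence of the output laws
`Q_x` from `ν`, minus the divergence of the output mixture from `ν`. It is therefore at most `max_x
D(Q_x ‖ ν)`. Suppose finitely many laws `T j` and numbers `u j > 0` are such that each `Q_x`
satisfies `D(Q_x ‖ T j) ≤ log (u j)` for some `j`. The mixture of the `T j` with weights
proportional to `u j` then lies within `log (∑ u j)` of every `Q_x`
(`exists_isGreatest_mutualInfo_of_cover`). The maximum exists because information is continuous on
the compact simplex of input laws.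

It remains to choose a cover of total weight at most `p * exp L`, with `L` the outer maximum in the
bound. An output law of weight `k ≥ m` is a nondegenerate centred Gaussian. Its divergence from the
isotropic Gaussian of variance `(k / m) * max ‖A(i)‖²` is at most `c̃(k)`, since the trace term is
bounded by the dimension and the constants `2πe` cancel. For `m ≥ 2`, one such Gaussian of weight
`exp L` serves each `k` with `m ≤ k < p`. Each input of weight below `m`, and the all-ones input, is
covered by its own output law at weight `1`. Binomial monotonicity gives `∑_{k<m} C(p,k) + 1 ≤ m *
C(p,m-1)`, so the total is at most `m * exp L + (p - m) * exp L`. That count fails for `m = 1`,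
where one wide Gaussian covers all nonzero inputs instead. -/

namespace SparseChannel

/-! ### Information as a functional on the simplex of input weights -/

section Functional

variable {ι E : Type*} [Fintype ι] [MeasurableSpace E]

/-- The mutual information between an input with weights `q` on a finite alphabet and the output
of a channel whose output laws have densities `g x` with respect to `ν`. -/
noncomputable def information (ν : Measure E) (g : ι → E → ℝ) (q : ι → ℝ) : ℝ :=
  ∑ x, q x * ∫ y, g x y * Real.log (g x y) ∂ν
    - ∫ y, (∑ x, q x * g x y) * Real.log (∑ x, q x * g x y) ∂ν

lemma sub_one_le_mul_log {t : ℝ} (ht : 0 ≤ t) : t - 1 ≤ t * Real.log t := by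
  rcases ht.eq_or_lt with rfl | ht
  · simp
  · have h := Real.one_sub_inv_le_log_of_pos ht
    have := mul_le_mul_of_nonneg_left h ht.le
    rwa [mul_sub, mul_inv_cancel₀ ht.ne', mul_one] at this

/-- Convexity of `t log t` bounds it above and `t - 1 ≤ t log t` below. The bound does not depend on
`q`, so it serves as the dominating function for continuity in `q`. -/
lemma abs_sum_mul_log_le {q : ι → ℝ} (hq : q ∈ stdSimplex ℝ ι) {a : ι → ℝ} (ha : ∀ x, 0 ≤ a x) :
    |(∑ x, q x * a x) * Real.log (∑ x, q x * a x)| ≤ 1 + ∑ x, |a x * Real.log (a x)| := by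
  have h0 : 0 ≤ ∑ x, q x * a x := Finset.sum_nonneg fun x _ => mul_nonneg (hq.1 x) (ha x)
  have hs : 0 ≤ ∑ x, |a x * Real.log (a x)| := Finset.sum_nonneg fun x _ => abs_nonneg _
  have hle1 : ∀ x, q x ≤ 1 := fun x =>
    hq.2 ▸ Finset.single_le_sum (f := q) (fun i _ => hq.1 i) (Finset.mem_univ x)
  rw [abs_le]
  constructor
  · linarith [sub_one_le_mul_log h0]
  · have h := Real.convexOn_mul_log.map_sum_le (t := Finset.univ) (w := q) (p := a)
      (fun i _ => hq.1 i) hq.2 (fun i _ => ha i)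
    simp only [smul_eq_mul] at h
    refine h.trans ?_
    have : ∑ x, q x * (a x * Real.log (a x)) ≤ ∑ x, |a x * Real.log (a x)| := by
      refine Finset.sum_le_sum fun x _ => ?_
      calc q x * (a x * Real.log (a x)) ≤ q x * |a x * Real.log (a x)| :=
            mul_le_mul_of_nonneg_left (le_abs_self _) (hq.1 x)
        _ ≤ 1 * |a x * Real.log (a x)| := mul_le_mul_of_nonneg_right (hle1 x) (abs_nonneg _)
        _ = _ := one_mul _
    linarith

variable {ν : Measure E} {g : ι → E → ℝ}

lemma measurable_mixture (hm : ∀ x, Measurable (g x)) (q : ι → ℝ) :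
    Measurable fun y => ∑ x, q x * g x y :=
  Finset.measurable_sum _ fun x _ => (hm x).const_mul (q x)

lemma integrable_mixture_mul_log [IsFiniteMeasure ν] (hm : ∀ x, Measurable (g x))
    (hg : ∀ x y, 0 ≤ g x y) (hi : ∀ x, Integrable (fun y => g x y * Real.log (g x y)) ν)
    {q : ι → ℝ} (hq : q ∈ stdSimplex ℝ ι) :
    Integrable (fun y => (∑ x, q x * g x y) * Real.log (∑ x, q x * g x y)) ν := by
  have hM := measurable_mixture hm q
  refine ((integrable_const (1 : ℝ)).add (integrable_finsetSum Finset.univ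
    fun x _ => (hi x).abs)).mono' (hM.mul hM.log).aestronglyMeasurable (ae_of_all _ fun y => ?_)
  simpa using abs_sum_mul_log_le hq (fun x => hg x y)

lemma continuousOn_information [IsFiniteMeasure ν] (hm : ∀ x, Measurable (g x))
    (hg : ∀ x y, 0 ≤ g x y) (hi : ∀ x, Integrable (fun y => g x y * Real.log (g x y)) ν) :
    ContinuousOn (information ν g) (stdSimplex ℝ ι) := by
  refine ContinuousOn.sub (Continuous.continuousOn (by fun_prop)) ?_
  refine continuousOn_of_dominated (bound := fun y => 1 + ∑ x, |g x y * Real.log (g x y)|)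
    (fun q _ => ?_) (fun q hq => ae_of_all _ fun y => ?_) ?_ (ae_of_all _ fun y => ?_)
  · have hM := measurable_mixture hm q
    exact (hM.mul hM.log).aestronglyMeasurable
  · exact abs_sum_mul_log_le hq (fun x => hg x y)
  · exact (integrable_const (1 : ℝ)).add (integrable_finsetSum Finset.univ fun x _ => (hi x).abs)
  · have h : Continuous fun q : ι → ℝ => ∑ x, q x * g x y := by fun_prop
    exact (Real.continuous_mul_log.comp h).continuousOn

/-- The subtracted integral is the divergence of the mixture from `ν`, which is nonnegative; what
remains is an average of divergences. -/
lemma information_le [IsProbabilityMeasure ν] (hm : ∀ x, Measurable (g x))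
    (hg : ∀ x y, 0 ≤ g x y) (hi : ∀ x, Integrable (fun y => g x y * Real.log (g x y)) ν)
    (hgi : ∀ x, Integrable (g x) ν) (h1 : ∀ x, ∫ y, g x y ∂ν = 1) {b : ℝ}
    (hb : ∀ x, ∫ y, g x y * Real.log (g x y) ∂ν ≤ b) {q : ι → ℝ} (hq : q ∈ stdSimplex ℝ ι) :
    information ν g q ≤ b := by
  have hle : ∑ x, q x * ∫ y, g x y * Real.log (g x y) ∂ν ≤ b := by
    calc ∑ x, q x * ∫ y, g x y * Real.log (g x y) ∂ν ≤ ∑ x, q x * b :=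
          Finset.sum_le_sum fun x _ => mul_le_mul_of_nonneg_left (hb x) (hq.1 x)
      _ = b := by rw [← Finset.sum_mul, hq.2, one_mul]
  have hMi : Integrable (fun y => ∑ x, q x * g x y) ν :=
    integrable_finsetSum _ fun x _ => (hgi x).const_mul (q x)
  have hM1 : ∫ y, (∑ x, q x * g x y) - 1 ∂ν = 0 := by
    rw [integral_sub hMi (integrable_const _), integral_finsetSum _
      fun x _ => (hgi x).const_mul (q x)]
    simp [integral_const_mul, h1, hq.2]
  have hge : 0 ≤ ∫ y, (∑ x, q x * g x y) * Real.log (∑ x, q x * g x y) ∂ν := by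
    rw [← hM1]
    refine integral_mono (hMi.sub (integrable_const _))
      (integrable_mixture_mul_log hm hg hi hq) fun y => ?_
    exact sub_one_le_mul_log (Finset.sum_nonneg fun x _ => mul_nonneg (hq.1 x) (hg x y))
  unfold information
  linarith

end Functional

lemma toReal_mem_stdSimplex {ι : Type*} [Fintype ι] (P : PMF ι) :
    (fun x => (P x).toReal) ∈ stdSimplex ℝ ι := by
  refine ⟨fun x => ENNReal.toReal_nonneg, ?_⟩
  rw [← ENNReal.toReal_sum fun x _ => P.apply_ne_top x]
  have := P.tsum_coe
  rw [tsum_fintype] at this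
  simp [this]

/-! ### Mutual information through output densities, and attainment of capacity -/

section Channel

variable {ι E Ω : Type*} [Fintype ι] [MeasurableSpace ι] [DiscreteMeasurableSpace ι]
  [MeasurableSpace E] [MeasurableSpace Ω]
  {μ : Measure Ω} [IsProbabilityMeasure μ] {F : ι → Ω → E}
  {ν : Measure E} {g : ι → E → ℝ}

lemma measurable_uncurry_of_discrete {α β : Type*} [MeasurableSpace α] [MeasurableSpace β]
    {f : ι → α → β} (hf : ∀ x, Measurable (f x)) :
    Measurable fun z : ι × α => f z.1 z.2 :=
  measurable_from_prod_countable_right hf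

lemma map_input_output [SFinite ν] (P : PMF ι) (hF : ∀ x, Measurable (F x))
    (hm : ∀ x, Measurable (g x))
    (hd : ∀ x, μ.map (F x) = ν.withDensity fun y => ENNReal.ofReal (g x y)) :
    (P.toMeasure.prod μ).map (fun ω => (ω.1, F ω.1 ω.2)) =
      (P.toMeasure.prod ν).withDensity fun z => ENNReal.ofReal (g z.1 z.2) := by
  have hFm := measurable_uncurry_of_discrete hF
  have hgm := (measurable_uncurry_of_discrete hm).ennreal_ofReal
  ext s hs
  rw [Measure.map_apply (measurable_fst.prodMk hFm) hs,
    Measure.prod_apply ((measurable_fst.prodMk hFm) hs), withDensity_apply _ hs,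
    ← lintegral_indicator hs, lintegral_prod _ (hgm.indicator hs).aemeasurable]
  refine lintegral_congr fun x => ?_
  have hs' : MeasurableSet (Prod.mk x ⁻¹' s) := measurable_prodMk_left hs
  have : (Prod.mk x ⁻¹' ((fun ω : ι × Ω => (ω.1, F ω.1 ω.2)) ⁻¹' s)) =
      F x ⁻¹' (Prod.mk x ⁻¹' s) := rfl
  rw [this, ← Measure.map_apply (hF x) hs', hd x, withDensity_apply _ hs',
    ← lintegral_indicator hs']
  rfl

lemma map_output (P : PMF ι) (hF : ∀ x, Measurable (F x)) (hm : ∀ x, Measurable (g x))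
    (hg : ∀ x y, 0 ≤ g x y)
    (hd : ∀ x, μ.map (F x) = ν.withDensity fun y => ENNReal.ofReal (g x y)) :
    (P.toMeasure.prod μ).map (fun ω => F ω.1 ω.2) =
      ν.withDensity fun y => ENNReal.ofReal (∑ x, (P x).toReal * g x y) := by
  have hFm := measurable_uncurry_of_discrete hF
  ext s hs
  rw [Measure.map_apply hFm hs, Measure.prod_apply (hFm hs), withDensity_apply _ hs]
  have h1 : ∀ x, μ (Prod.mk x ⁻¹' ((fun ω : ι × Ω => F ω.1 ω.2) ⁻¹' s)) =
      ∫⁻ y in s, ENNReal.ofReal (g x y) ∂ν := fun x => by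
    have : (Prod.mk x ⁻¹' ((fun ω : ι × Ω => F ω.1 ω.2) ⁻¹' s)) = F x ⁻¹' s := rfl
    rw [this, ← Measure.map_apply (hF x) hs, hd x, withDensity_apply _ hs]
  simp_rw [h1]
  rw [lintegral_fintype]
  have h2 : ∀ y, ENNReal.ofReal (∑ x, (P x).toReal * g x y) =
      ∑ x, P x * ENNReal.ofReal (g x y) := fun y => by
    rw [ENNReal.ofReal_sum_of_nonneg fun x _ => mul_nonneg ENNReal.toReal_nonneg (hg x y)]
    refine Finset.sum_congr rfl fun x _ => ?_
    rw [ENNReal.ofReal_mul ENNReal.toReal_nonneg, ENNReal.ofReal_toReal (P.apply_ne_top x)]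
  simp_rw [h2]
  rw [lintegral_finsetSum _ fun x _ => (hm x).ennreal_ofReal.const_mul _]
  refine Finset.sum_congr rfl fun x _ => ?_
  rw [lintegral_const_mul _ (hm x).ennreal_ofReal,
    P.toMeasure_apply_singleton _ (measurableSet_singleton x), mul_comm]

lemma integrable_density {Q : Measure E} [IsFiniteMeasure Q] {f : E → ℝ} (hf : Measurable f)
    (h0 : ∀ y, 0 ≤ f y) (hd : Q = ν.withDensity fun y => ENNReal.ofReal (f y)) :
    Integrable f ν := by
  refine (lintegral_ofReal_ne_top_iff_integrable hf.aestronglyMeasurable (ae_of_all _ h0)).1 ?_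
  have := measure_ne_top Q Set.univ
  rwa [hd, withDensity_apply _ MeasurableSet.univ, Measure.restrict_univ] at this

lemma integral_density {Q : Measure E} [IsProbabilityMeasure Q] {f : E → ℝ} (hf : Measurable f)
    (h0 : ∀ y, 0 ≤ f y) (hd : Q = ν.withDensity fun y => ENNReal.ofReal (f y)) :
    ∫ y, f y ∂ν = 1 := by
  rw [integral_eq_lintegral_of_nonneg_ae (ae_of_all _ h0) hf.aestronglyMeasurable]
  have := measure_univ (μ := Q)
  rw [hd, withDensity_apply _ MeasurableSet.univ, Measure.restrict_univ] at this
  simp [this]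

/-- The mutual information of a finite-input channel, in terms of output densities. -/
theorem mutualInfo_eq_information [IsProbabilityMeasure ν] (P : PMF ι)
    (hF : ∀ x, Measurable (F x))
    (hm : ∀ x, Measurable (g x)) (hg : ∀ x y, 0 ≤ g x y)
    (hi : ∀ x, Integrable (fun y => g x y * Real.log (g x y)) ν)
    (hd : ∀ x, μ.map (F x) = ν.withDensity fun y => ENNReal.ofReal (g x y)) :
    mutualInfo (fun ω : ι × Ω => ω.1) (fun ω => F ω.1 ω.2) (P.toMeasure.prod μ) =
      ENNReal.ofReal (information ν g fun x => (P x).toReal) := by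
  have hFm := measurable_uncurry_of_discrete hF
  have hgm := measurable_uncurry_of_discrete hm
  set q : ι → ℝ := fun x => (P x).toReal with hqdef
  have hq : q ∈ stdSimplex ℝ ι := toReal_mem_stdSimplex P
  set G : E → ℝ := fun y => ∑ x, q x * g x y with hG
  have hGm : Measurable G := measurable_mixture hm q
  have hG0 : ∀ y, 0 ≤ G y := fun y => Finset.sum_nonneg fun x _ => mul_nonneg (hq.1 x) (hg x y)
  have hqG : ∀ x y, q x * g x y ≤ G y := fun x y =>
    Finset.single_le_sum (f := fun x => q x * g x y)
      (fun x _ => mul_nonneg (hq.1 x) (hg x y)) (Finset.mem_univ x)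
  have hGi : Integrable (fun y => G y * Real.log (G y)) ν := integrable_mixture_mul_log hm hg hi hq
  -- Dominated by `G log G`, because `q x * g x ≤ G`.
  have hqGi : ∀ x, Integrable (fun y => q x * g x y * Real.log (G y)) ν := fun x => by
    refine hGi.mono (((hm x).const_mul _).mul hGm.log).aestronglyMeasurable
      (ae_of_all _ fun y => ?_)
    rw [norm_mul _ (Real.log _), norm_mul _ (Real.log _),
      Real.norm_of_nonneg (mul_nonneg (hq.1 x) (hg x y)), Real.norm_of_nonneg (hG0 y)]
    exact mul_le_mul_of_nonneg_right (hqG x y) (norm_nonneg _)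
  have hsplit : ∀ x, q x ≠ 0 → ∀ y, g x y * Real.log (g x y / G y) =
      g x y * Real.log (g x y) - (q x)⁻¹ * (q x * g x y * Real.log (G y)) := fun x hx y => by
    rcases (hg x y).eq_or_lt with h | h
    · simp [← h]
    · have : 0 < G y := (mul_pos ((hq.1 x).lt_of_ne' hx) h).trans_le (hqG x y)
      rw [Real.log_div h.ne' this.ne']
      field_simp
  have hrat : ∀ x, q x ≠ 0 → Integrable (fun y => g x y * Real.log (g x y / G y)) ν :=
    fun x hx => by
      simp_rw [hsplit x hx]
      exact (hi x).sub ((hqGi x).const_mul _)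
  have hJ := map_input_output P hF hm hd
  have hPX : (P.toMeasure.prod μ).map (fun ω : ι × Ω => ω.1) = P.toMeasure := by
    simp
  have hPY := map_output P hF hm hg hd
  have : IsProbabilityMeasure ((P.toMeasure.prod μ).map (fun ω => F ω.1 ω.2)) :=
    Measure.isProbabilityMeasure_map hFm.aemeasurable
  have : IsProbabilityMeasure ((P.toMeasure.prod μ).map (fun ω => (ω.1, F ω.1 ω.2))) :=
    Measure.isProbabilityMeasure_map (measurable_fst.prodMk hFm).aemeasurable
  unfold mutualInfo
  rw [hPX]
  set J := (P.toMeasure.prod μ).map (fun ω => (ω.1, F ω.1 ω.2)) with hJdef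
  set PY := (P.toMeasure.prod μ).map (fun ω => F ω.1 ω.2) with hPYdef
  have hN : P.toMeasure.prod PY =
      (P.toMeasure.prod ν).withDensity fun z => ENNReal.ofReal (G z.2) := by
    rw [hPY, prod_withDensity_right hGm.ennreal_ofReal]
  have hrm : Measurable fun z : ι × E => g z.1 z.2 / G z.2 := hgm.div (hGm.comp measurable_snd)
  -- An input of mass zero may have `g x > 0` where `G = 0`, making the ratio `g / G` meaningless;
  -- such inputs are null.
  have hP : ∀ᵐ z ∂P.toMeasure.prod ν, q z.1 ≠ 0 := by
    refine Measure.quasiMeasurePreserving_fst.ae (p := fun x => q x ≠ 0) ?_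
    rw [ae_iff, P.toMeasure_apply_eq_zero_iff (Set.toFinite _).measurableSet]
    rw [Set.disjoint_left]
    intro x hx h
    simp only [ne_eq, not_not, Set.mem_ofPred_eq, hqdef, ENNReal.toReal_eq_zero_iff] at h
    exact h.elim ((PMF.mem_support_iff _ _).1 hx) (P.apply_ne_top x)
  have hJN : J = (P.toMeasure.prod PY).withDensity
      fun z => ENNReal.ofReal (g z.1 z.2 / G z.2) := by
    rw [hN, hJ]
    refine Eq.trans ?_
      (withDensity_mul _ (hGm.comp measurable_snd).ennreal_ofReal hrm.ennreal_ofReal)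
    refine withDensity_congr_ae ?_
    filter_upwards [hP] with z hz
    simp only [Pi.mul_apply]
    rw [← ENNReal.ofReal_mul (hG0 _)]
    congr 1
    rcases (hg z.1 z.2).eq_or_lt with h | h
    · simp [← h]
    · have : 0 < G z.2 := (mul_pos ((hq.1 _).lt_of_ne' hz) h).trans_le (hqG z.1 z.2)
      field_simp
  have hac : J ≪ P.toMeasure.prod PY := hJN ▸ withDensity_absolutelyContinuous _ _
  have hllr : llr J (P.toMeasure.prod PY) =ᵐ[J] fun z => Real.log (g z.1 z.2 / G z.2) := by
    refine hac.ae_le ?_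
    have := Measure.rnDeriv_withDensity (P.toMeasure.prod PY) hrm.ennreal_ofReal
    rw [← hJN] at this
    filter_upwards [this] with z hz
    rw [llr, hz, ENNReal.toReal_ofReal (div_nonneg (hg _ _) (hG0 _))]
  have hint : Integrable (fun z : ι × E => g z.1 z.2 * Real.log (g z.1 z.2 / G z.2))
      (P.toMeasure.prod ν) := by
    refine (integrable_prod_iff (hgm.mul hrm.log).aestronglyMeasurable).2 ?_
    refine ⟨?_, Integrable.of_finite⟩
    have hP' : ∀ᵐ x ∂P.toMeasure, q x ≠ 0 := by
      have := Measure.ae_ae_of_ae_prod hP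
      filter_upwards [this] with x hx
      simpa using hx
    filter_upwards [hP'] with x hx using hrat x hx
  have hllri : Integrable (llr J (P.toMeasure.prod PY)) J := by
    refine Integrable.congr ?_ hllr.symm
    rw [hJ, integrable_withDensity_iff_integrable_smul' hgm.ennreal_ofReal
      (ae_of_all _ fun z => ENNReal.ofReal_lt_top)]
    refine hint.congr (ae_of_all _ fun z => ?_)
    simp [ENNReal.toReal_ofReal (hg z.1 z.2)]
  rw [InformationTheory.klDiv_of_ac_of_integrable hac hllri]
  congr 1
  rw [integral_congr_ae hllr]
  have e1 : ∫ z, Real.log (g z.1 z.2 / G z.2) ∂J =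
      ∫ z, g z.1 z.2 * Real.log (g z.1 z.2 / G z.2) ∂(P.toMeasure.prod ν) := by
    rw [hJ, integral_withDensity_eq_integral_toReal_smul hgm.ennreal_ofReal
      (ae_of_all _ fun z => ENNReal.ofReal_lt_top)]
    refine integral_congr_ae (ae_of_all _ fun z => ?_)
    simp [ENNReal.toReal_ofReal (hg z.1 z.2)]
  rw [e1, integral_prod _ hint, PMF.integral_eq_sum]
  have e2 : ∀ x, (P x).toReal • ∫ y, g x y * Real.log (g x y / G y) ∂ν =
      q x * ∫ y, g x y * Real.log (g x y) ∂ν - ∫ y, q x * g x y * Real.log (G y) ∂ν := by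
    intro x
    by_cases hx : q x = 0
    · have : (P x).toReal = 0 := hx
      simp [hx, this]
    · simp_rw [hsplit x hx]
      rw [integral_sub (hi x) ((hqGi x).const_mul _), integral_const_mul, smul_eq_mul]
      change q x * _ = _
      rw [mul_sub, mul_inv_cancel_left₀ hx]
  simp_rw [e2]
  rw [Finset.sum_sub_distrib, ← integral_finsetSum _ fun x _ => hqGi x]
  simp only [← Finset.sum_mul]
  simp [information, hG]

/-- A finite-input channel whose output laws have divergence at most `b` from a fixed law attains
its capacity, which is at most `b`. -/
theorem exists_isGreatest_mutualInfo [IsProbabilityMeasure ν] [Nonempty ι]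
    (hF : ∀ x, Measurable (F x))
    (hm : ∀ x, Measurable (g x)) (hg : ∀ x y, 0 ≤ g x y)
    (hi : ∀ x, Integrable (fun y => g x y * Real.log (g x y)) ν)
    (hd : ∀ x, μ.map (F x) = ν.withDensity fun y => ENNReal.ofReal (g x y))
    {b : ℝ} (hb0 : 0 ≤ b) (hb : ∀ x, ∫ y, g x y * Real.log (g x y) ∂ν ≤ b) :
    ∃ C : NNReal, IsGreatest (Set.range fun P : PMF ι =>
      mutualInfo (fun ω : ι × Ω => ω.1) (fun ω => F ω.1 ω.2) (P.toMeasure.prod μ)) (C : ENNReal) ∧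
      (C : ℝ) ≤ b := by
  classical
  obtain ⟨q, hq, hmax⟩ := (isCompact_stdSimplex ℝ ι).exists_isMaxOn
    ⟨_, single_mem_stdSimplex ℝ (Classical.arbitrary ι)⟩ (continuousOn_information hm hg hi)
  have hprob : ∀ x, IsProbabilityMeasure (μ.map (F x)) := fun x =>
    Measure.isProbabilityMeasure_map (hF x).aemeasurable
  refine ⟨(information ν g q).toNNReal, ⟨?_, ?_⟩, ?_⟩
  · have hsum : ∑ x, ENNReal.ofReal (q x) = 1 := by
      rw [← ENNReal.ofReal_sum_of_nonneg fun x _ => hq.1 x, hq.2, ENNReal.ofReal_one]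
    refine ⟨PMF.ofFintype (fun x => ENNReal.ofReal (q x)) hsum, ?_⟩
    simp only
    rw [mutualInfo_eq_information _ hF hm hg hi hd]
    have : (fun x => ((PMF.ofFintype (fun x => ENNReal.ofReal (q x)) hsum) x).toReal) = q := by
      funext x
      simp [ENNReal.toReal_ofReal (hq.1 x)]
    rw [this]
    rfl
  · rintro _ ⟨P, rfl⟩
    simp only
    rw [mutualInfo_eq_information _ hF hm hg hi hd]
    exact ENNReal.ofReal_le_ofReal (hmax (toReal_mem_stdSimplex P))
  · rw [Real.coe_toNNReal']
    refine max_le (information_le hm hg hi (fun x => ?_) (fun x => ?_) hb hq) hb0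
    · exact integrable_density (hm x) (hg x) (hd x)
    · exact integral_density (hm x) (hg x) (hd x)

end Channel


/-! ### Divergence bounds and mixtures -/

section Divergence

variable {E : Type*} [MeasurableSpace E] {Q T ν : Measure E} {b : ℝ}

/-- `Q` has a density with respect to `T`, and its divergence from `T` is at most `b`. -/
def HasDivergenceLE (Q T : Measure E) (b : ℝ) : Prop :=
  ∃ h : E → ℝ, Measurable h ∧ (∀ y, 0 ≤ h y) ∧ Q = T.withDensity (fun y => ENNReal.ofReal (h y)) ∧
    Integrable (fun y => Real.log (h y)) Q ∧ ∫ y, Real.log (h y) ∂Q ≤ b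

lemma HasDivergenceLE.mono_right {b' : ℝ} (H : HasDivergenceLE Q T b) (hb : b ≤ b') :
    HasDivergenceLE Q T b' := by
  obtain ⟨h, h1, h2, h3, h4, h5⟩ := H
  exact ⟨h, h1, h2, h3, h4, h5.trans hb⟩

lemma HasDivergenceLE.refl (Q : Measure E) : HasDivergenceLE Q Q 0 := by
  refine ⟨fun _ => 1, measurable_const, fun _ => zero_le_one, ?_, ?_, ?_⟩
  · simp
  · simp
  · simp

/-- Scaling the reference by `c` divides the density by `c`. The logarithm splits only where `h >
0`, which holds `Q`-almost everywhere. -/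
lemma HasDivergenceLE.smul [IsProbabilityMeasure Q] (H : HasDivergenceLE Q T b) {c : ℝ}
    (hc : 0 < c) : HasDivergenceLE Q (ENNReal.ofReal c • T) (b - Real.log c) := by
  obtain ⟨h, hm, h0, hQ, hi, hb⟩ := H
  have hae : (fun y => Real.log (c⁻¹ * h y)) =ᵐ[Q] fun y => Real.log (h y) - Real.log c := by
    have : ∀ᵐ y ∂Q, 0 < h y := by
      rw [hQ, ae_withDensity_iff hm.ennreal_ofReal]
      refine ae_of_all _ fun y hy => ?_
      exact ENNReal.ofReal_pos.1 (pos_iff_ne_zero.2 hy)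
    filter_upwards [this] with y hy
    rw [Real.log_mul (inv_ne_zero hc.ne') hy.ne', Real.log_inv]
    ring
  refine ⟨fun y => c⁻¹ * h y, hm.const_mul _, fun y => mul_nonneg (inv_nonneg.2 hc.le) (h0 y),
    ?_, ?_, ?_⟩
  · rw [withDensity_smul_measure, ← withDensity_smul _ (hm.const_mul _).ennreal_ofReal]
    rw [hQ]
    congr 1
    funext y
    rw [Pi.smul_apply, smul_eq_mul, ← ENNReal.ofReal_mul hc.le, mul_inv_cancel_left₀ hc.ne']
  · exact (hi.sub (integrable_const _)).congr hae.symm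
  · rw [integral_congr_ae hae, integral_sub hi (integrable_const _)]
    simpa using hb

/-- Enlarging the reference measure can only lower the divergence: `T` has density `s ≤ 1` with
respect to `ν`, so `log (s h) ≤ log h` wherever `s h > 0`. -/
lemma HasDivergenceLE.exists_density [IsFiniteMeasure Q] [IsFiniteMeasure ν]
    (H : HasDivergenceLE Q T b) (hT : T ≤ ν) :
    ∃ g : E → ℝ, Measurable g ∧ (∀ y, 0 ≤ g y) ∧
      Q = ν.withDensity (fun y => ENNReal.ofReal (g y)) ∧
      Integrable (fun y => g y * Real.log (g y)) ν ∧ ∫ y, g y * Real.log (g y) ∂ν ≤ b := by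
  obtain ⟨h, hm, h0, hQ, hi, hb⟩ := H
  have : IsFiniteMeasure T := isFiniteMeasure_of_le ν hT
  -- Truncating at `1` makes the almost-everywhere bound on the derivative hold everywhere.
  set s : E → ℝ := fun y => min (T.rnDeriv ν y).toReal 1 with hs
  have hsm : Measurable s := (Measure.measurable_rnDeriv T ν).ennreal_toReal.min measurable_const
  have hs0 : ∀ y, 0 ≤ s y := fun y => le_min ENNReal.toReal_nonneg zero_le_one
  have hTd : T = ν.withDensity fun y => ENNReal.ofReal (s y) := by
    refine (Measure.withDensity_rnDeriv_eq T ν (Measure.absolutelyContinuous_of_le hT)).symm.trans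
      (withDensity_congr_ae ?_)
    filter_upwards [Measure.rnDeriv_le_one_of_le hT] with y hy
    have hne : T.rnDeriv ν y ≠ ⊤ := (hy.trans_lt ENNReal.one_lt_top).ne
    have hle : (T.rnDeriv ν y).toReal ≤ 1 := by
      simpa using ENNReal.toReal_mono ENNReal.one_ne_top hy
    rw [hs]
    simp only
    rw [min_eq_left hle, ENNReal.ofReal_toReal hne]
  have hgm : Measurable fun y => s y * h y := hsm.mul hm
  have hg0 : ∀ y, 0 ≤ s y * h y := fun y => mul_nonneg (hs0 y) (h0 y)
  have hQd : Q = ν.withDensity fun y => ENNReal.ofReal (s y * h y) := by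
    rw [hQ, hTd, ← withDensity_mul _ hsm.ennreal_ofReal hm.ennreal_ofReal]
    congr 1
    funext y
    rw [Pi.mul_apply, ENNReal.ofReal_mul (hs0 y)]
  have hle : ∀ y, s y * h y * Real.log (s y * h y) ≤ s y * h y * Real.log (h y) := fun y => by
    rcases (hg0 y).eq_or_lt with hz | hz
    · simp [← hz]
    · refine mul_le_mul_of_nonneg_left (Real.log_le_log hz ?_) hz.le
      exact mul_le_of_le_one_left (h0 y) (min_le_right _ _)
  have hi' : Integrable (fun y => s y * h y * Real.log (h y)) ν := by
    rw [hQd, integrable_withDensity_iff_integrable_smul' hgm.ennreal_ofReal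
      (ae_of_all _ fun z => ENNReal.ofReal_lt_top)] at hi
    refine hi.congr (ae_of_all _ fun y => ?_)
    simp only [ENNReal.toReal_ofReal (hg0 y), smul_eq_mul]
  have he : ∫ y, Real.log (h y) ∂Q = ∫ y, s y * h y * Real.log (h y) ∂ν := by
    rw [hQd, integral_withDensity_eq_integral_toReal_smul hgm.ennreal_ofReal
      (ae_of_all _ fun z => ENNReal.ofReal_lt_top)]
    refine integral_congr_ae (ae_of_all _ fun y => ?_)
    simp only [ENNReal.toReal_ofReal (hg0 y), smul_eq_mul]
  have hgi : Integrable (fun y => s y * h y * Real.log (s y * h y)) ν := by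
    refine (hi'.abs.add (integrable_const (1 : ℝ))).mono' (hgm.mul hgm.log).aestronglyMeasurable
      (ae_of_all _ fun y => ?_)
    rw [Real.norm_eq_abs, abs_le]
    have h1 := le_abs_self (s y * h y * Real.log (h y))
    have h2 := abs_nonneg (s y * h y * Real.log (h y))
    have h3 := sub_one_le_mul_log (hg0 y)
    simp only [Pi.add_apply]
    constructor
    · linarith [hg0 y]
    · linarith [hle y]
  exact ⟨_, hgm, hg0, hQd, hgi, (integral_mono hgi hi' hle).trans (he ▸ hb)⟩

end Divergence

/-- If each output law is within divergence `log (u j)` of one of finitely many laws `T j`, the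
capacity is attained and is at most `log (∑ j, u j)`. -/
theorem exists_isGreatest_mutualInfo_of_cover {ι E Ω J : Type*} [Fintype ι] [Nonempty ι]
    [MeasurableSpace ι] [DiscreteMeasurableSpace ι] [MeasurableSpace E] [MeasurableSpace Ω]
    [Fintype J] {μ : Measure Ω} [IsProbabilityMeasure μ] {F : ι → Ω → E}
    (hF : ∀ x, Measurable (F x)) (T : J → Measure E) [∀ j, IsProbabilityMeasure (T j)]
    (u : J → ℝ) (hu : ∀ j, 0 < u j)
    (hcov : ∀ x, ∃ j, HasDivergenceLE (μ.map (F x)) (T j) (Real.log (u j)))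
    {Z : ℝ} (hZ : ∑ j, u j ≤ Z) (hZ1 : 1 ≤ Z) :
    ∃ C : NNReal, IsGreatest (Set.range fun P : PMF ι =>
      mutualInfo (fun ω : ι × Ω => ω.1) (fun ω => F ω.1 ω.2) (P.toMeasure.prod μ)) (C : ENNReal) ∧
      (C : ℝ) ≤ Real.log Z := by
  set S := ∑ j, u j with hS
  obtain ⟨j₀, -⟩ := hcov (Classical.arbitrary ι)
  have hS0 : 0 < S := Finset.sum_pos (fun j _ => hu j) ⟨j₀, Finset.mem_univ _⟩
  set ν : Measure E := ∑ j, ENNReal.ofReal (u j / S) • T j with hν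
  have hνp : IsProbabilityMeasure ν := by
    constructor
    simp only [hν, Measure.coe_finsetSum, Finset.sum_apply, Measure.smul_apply, measure_univ,
      smul_eq_mul, mul_one]
    rw [← ENNReal.ofReal_sum_of_nonneg fun j _ => (div_pos (hu j) hS0).le, ← Finset.sum_div,
      ← hS, div_self hS0.ne', ENNReal.ofReal_one]
  have hprob : ∀ x, IsProbabilityMeasure (μ.map (F x)) := fun x =>
    Measure.isProbabilityMeasure_map (hF x).aemeasurable
  have key : ∀ x, ∃ g : E → ℝ, Measurable g ∧ (∀ y, 0 ≤ g y) ∧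
      μ.map (F x) = ν.withDensity (fun y => ENNReal.ofReal (g y)) ∧
      Integrable (fun y => g y * Real.log (g y)) ν ∧
      ∫ y, g y * Real.log (g y) ∂ν ≤ Real.log Z := fun x => by
    obtain ⟨j, hj⟩ := hcov x
    -- `ν` dominates `(u j / S) • T j`, and `log (u j) - log (u j / S) = log S`.
    refine ((hj.smul (div_pos (hu j) hS0)).mono_right ?_).exists_density ?_
    · rw [Real.log_div (hu j).ne' hS0.ne']
      linarith [Real.log_le_log hS0 hZ]
    · refine Measure.le_iff.2 fun s _ => ?_
      simp only [hν, Measure.coe_finsetSum, Finset.sum_apply]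
      exact Finset.single_le_sum (f := fun j => (ENNReal.ofReal (u j / S) • T j) s)
        (fun _ _ => zero_le) (Finset.mem_univ j)
  choose g hgm hg0 hgd hgi hgb using key
  exact exists_isGreatest_mutualInfo hF hgm hg0 hgi hgd (Real.log_nonneg hZ1) hgb

open Matrix

/-! ### Centred Gaussian laws and their divergence from isotropic ones -/

section Gaussian

variable {m n p : ℕ}

instance isProbabilityMeasure_multiplierLaw (n : ℕ) : IsProbabilityMeasure (multiplierLaw n) := by
  unfold multiplierLaw
  infer_instance

lemma measurable_mulVec (M : Matrix (Fin m) (Fin n) ℝ) : Measurable fun z => M *ᵥ z := by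
  have : Continuous fun z => M *ᵥ z := by fun_prop
  exact this.measurable

/-- The centred Gaussian law `M Z` with `Z` standard Gaussian. -/
noncomputable def gaussianImage (M : Matrix (Fin m) (Fin n) ℝ) : Measure (Fin m → ℝ) :=
  (multiplierLaw n).map fun z => M *ᵥ z

instance (M : Matrix (Fin m) (Fin n) ℝ) : IsProbabilityMeasure (gaussianImage M) :=
  Measure.isProbabilityMeasure_map (measurable_mulVec M).aemeasurable

lemma charFunDual_multiplierLaw (L : StrongDual ℝ (Fin n → ℝ)) :
    charFunDual (multiplierLaw n) L = Complex.exp (-(∑ i, (L (Pi.single i 1)) ^ 2 : ℝ) / 2) := by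
  rw [multiplierLaw, charFunDual_pi]
  simp_rw [IsGaussian.charFunDual_eq]
  rw [← Complex.exp_sum]
  congr 1
  rw [Complex.ofReal_sum, ← Finset.sum_neg_distrib, Finset.sum_div]
  refine Finset.sum_congr rfl fun i _ => ?_
  rw [integral_complex_ofReal, integral_continuousLinearMap_gaussianReal, variance_continuousLinearMap_gaussianReal]
  simp [neg_div, sq_nonneg]

/-- A centred Gaussian law depends only on its covariance matrix. -/
lemma gaussianImage_eq_of_mul_transpose_eq {M : Matrix (Fin m) (Fin n) ℝ}
    {N : Matrix (Fin m) (Fin p) ℝ} (h : M * Mᵀ = N * Nᵀ) : gaussianImage M = gaussianImage N := by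
  have key : ∀ {k : ℕ} (K : Matrix (Fin m) (Fin k) ℝ) (L : StrongDual ℝ (Fin m → ℝ)),
      charFunDual (gaussianImage K) L = Complex.exp (-(((fun j => L (Pi.single j 1)) ⬝ᵥ
        ((K * Kᵀ) *ᵥ fun j => L (Pi.single j 1)) : ℝ)) / 2) := by
    intro k K L
    have h1 := charFunDual_map (μ := multiplierLaw k)
      (LinearMap.toContinuousLinearMap (Matrix.toLin' K)) L
    have h2 : (multiplierLaw k).map (LinearMap.toContinuousLinearMap (Matrix.toLin' K)) =
        gaussianImage K := rfl
    rw [← h2, h1, charFunDual_multiplierLaw]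
    congr 4
    have h3 : ∀ v : Fin m → ℝ, L v = v ⬝ᵥ fun j => L (Pi.single j 1) := fun v => by
      conv_lhs => rw [← Finset.univ_sum_single v, map_sum]
      refine Finset.sum_congr rfl fun j _ => ?_
      have : (Pi.single j (v j) : Fin m → ℝ) = v j • Pi.single j 1 := by
        rw [← Pi.single_smul', smul_eq_mul, mul_one]
      rw [this, map_smul, smul_eq_mul]
    rw [← Matrix.mulVec_mulVec, Matrix.dotProduct_mulVec, ← Matrix.mulVec_transpose]
    refine Finset.sum_congr rfl fun i _ => ?_
    have : (L.comp (LinearMap.toContinuousLinearMap (Matrix.toLin' K))) (Pi.single i 1) =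
        (Kᵀ *ᵥ fun j => L (Pi.single j 1)) i := by
      simp only [ContinuousLinearMap.comp_apply, LinearMap.coe_toContinuousLinearMap',
        Matrix.toLin'_apply]
      rw [h3, Matrix.mulVec_single_one]
      rfl
    rw [this, sq]
  refine Measure.ext_of_charFunDual (funext fun L => ?_)
  rw [key, key, h]

/-- The standard Gaussian density. -/
noncomputable def stdDensity (z : Fin n → ℝ) : ℝ := ∏ i, gaussianPDFReal 0 1 (z i)

lemma stdDensity_pos (z : Fin n → ℝ) : 0 < stdDensity z :=
  Finset.prod_pos fun _ _ => gaussianPDFReal_pos _ _ _ one_ne_zero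

lemma measurable_stdDensity : Measurable (stdDensity (n := n)) :=
  Finset.measurable_prod _ fun i _ =>
    (measurable_gaussianPDFReal 0 1).comp (measurable_pi_apply i)

lemma log_stdDensity (z : Fin n → ℝ) :
    Real.log (stdDensity z) = n * Real.log (√(2 * Real.pi))⁻¹ - (∑ i, z i ^ 2) / 2 := by
  rw [stdDensity, Real.log_prod fun i _ => (gaussianPDFReal_pos _ _ _ one_ne_zero).ne']
  have : ∀ i, Real.log (gaussianPDFReal 0 1 (z i)) =
      Real.log (√(2 * Real.pi))⁻¹ - z i ^ 2 / 2 := fun i => by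
    rw [gaussianPDFReal_def]
    simp only [NNReal.coe_one, mul_one, sub_zero]
    rw [Real.log_mul (by positivity) (Real.exp_pos _).ne', Real.log_exp]
    ring
  simp_rw [this]
  simp [Finset.sum_div]

lemma multiplierLaw_eq_withDensity :
    multiplierLaw n = volume.withDensity fun z => ENNReal.ofReal (stdDensity z) := by
  refine Measure.pi_eq fun s hs => ?_
  have hi : ∀ i, Integrable (gaussianPDFReal 0 1) (volume.restrict (s i)) := fun i =>
    (integrable_gaussianPDFReal 0 1).restrict
  rw [withDensity_apply _ (MeasurableSet.univ_pi hs), volume_pi, Measure.restrict_pi_pi,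
    ← ofReal_integral_eq_lintegral_ofReal (f := stdDensity) (Integrable.fintype_prod hi)
      (ae_of_all _ fun z => (stdDensity_pos z).le)]
  simp only [stdDensity]
  rw [integral_fintype_prod_eq_prod (fun _ => gaussianPDFReal 0 1), ENNReal.ofReal_prod_of_nonneg
    fun i _ => integral_nonneg fun _ => gaussianPDFReal_nonneg _ _ _]
  exact Finset.prod_congr rfl fun i _ =>
    (gaussianReal_apply_eq_integral 0 one_ne_zero (s i)).symm

/-- The density of `B Z`, for `B` invertible. -/
noncomputable def imageDensity (B : Matrix (Fin m) (Fin m) ℝ) (y : Fin m → ℝ) : ℝ :=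
  |B.det⁻¹| * stdDensity (B⁻¹ *ᵥ y)

lemma imageDensity_pos {B : Matrix (Fin m) (Fin m) ℝ} (hB : B.det ≠ 0) (y : Fin m → ℝ) :
    0 < imageDensity B y :=
  mul_pos (abs_pos.2 (inv_ne_zero hB)) (stdDensity_pos _)

lemma measurable_imageDensity (B : Matrix (Fin m) (Fin m) ℝ) : Measurable (imageDensity B) :=
  (measurable_stdDensity.comp (measurable_mulVec _)).const_mul _

lemma gaussianImage_eq_withDensity {B : Matrix (Fin m) (Fin m) ℝ} (hB : B.det ≠ 0) :
    gaussianImage B = volume.withDensity fun y => ENNReal.ofReal (imageDensity B y) := by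
  have hu : IsUnit B.det := hB.isUnit
  have hmap := Real.map_matrix_volume_pi_eq_smul_volume_pi hB
  have hmap' : (volume : Measure (Fin m → ℝ)).map (fun z => B *ᵥ z) =
    ENNReal.ofReal |B.det⁻¹| • volume := hmap
  ext s hs
  have hd : Measurable fun y => ENNReal.ofReal (stdDensity (B⁻¹ *ᵥ y)) :=
    (measurable_stdDensity.comp (measurable_mulVec _)).ennreal_ofReal
  rw [gaussianImage, Measure.map_apply (measurable_mulVec B) hs, multiplierLaw_eq_withDensity,
    withDensity_apply _ (measurable_mulVec B hs), withDensity_apply _ hs]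
  have h1 : ∀ z, ENNReal.ofReal (stdDensity z) =
      ENNReal.ofReal (stdDensity (B⁻¹ *ᵥ (B *ᵥ z))) := fun z => by
    rw [Matrix.mulVec_mulVec, Matrix.nonsing_inv_mul B hu, Matrix.one_mulVec]
  rw [lintegral_congr h1, ← setLIntegral_map hs hd (measurable_mulVec B), hmap', Measure.restrict_smul,
    lintegral_smul_measure, smul_eq_mul, ← lintegral_const_mul _ hd]
  simp only [imageDensity, ENNReal.ofReal_mul (abs_nonneg _)]

lemma memLp_const_mul_gaussianReal (c : ℝ) :
    MemLp (fun x : ℝ => c * x) 2 (gaussianReal 0 1) :=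
  MemLp.const_mul (memLp_id_gaussianReal' 2 (by simp)) c

lemma memLp_const_mul_eval (c : ℝ) (i : Fin n) :
    MemLp (fun z : Fin n → ℝ => c * z i) 2 (multiplierLaw n) :=
  (memLp_const_mul_gaussianReal c).comp_measurePreserving
    (measurePreserving_eval (fun _ => gaussianReal 0 1) i)

lemma memLp_mulVec (M : Matrix (Fin m) (Fin n) ℝ) (j : Fin m) :
    MemLp (fun z => (M *ᵥ z) j) 2 (multiplierLaw n) :=
  memLp_finsetSum Finset.univ fun i _ => memLp_const_mul_eval (M j i) i

lemma integral_sq_mulVec (M : Matrix (Fin m) (Fin n) ℝ) (j : Fin m) :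
    ∫ z, (M *ᵥ z) j ^ 2 ∂multiplierLaw n = ∑ i, M j i ^ 2 := by
  have h0 : ∫ z, (M *ᵥ z) j ∂multiplierLaw n = 0 := by
    simp only [Matrix.mulVec, dotProduct]
    rw [integral_finsetSum _ fun i _ =>
      (memLp_const_mul_eval (M j i) i).integrable (by norm_num)]
    refine Finset.sum_eq_zero fun i _ => ?_
    rw [integral_const_mul]
    have := integral_comp_eval (μ := fun _ : Fin n => gaussianReal 0 1) (i := i)
      (f := fun x : ℝ => x) (by fun_prop)
    rw [multiplierLaw, this, integral_id_gaussianReal, mul_zero]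
  rw [← variance_of_integral_eq_zero (memLp_mulVec M j).aemeasurable h0]
  have h1 := variance_sum_pi (μ := fun _ : Fin n => gaussianReal 0 1)
    (X := fun i (x : ℝ) => M j i * x) fun i => memLp_const_mul_gaussianReal (M j i)
  have h2 : (∑ i, fun ω : Fin n → ℝ => M j i * ω i) = fun z => (M *ᵥ z) j := by
    funext z
    simp [Matrix.mulVec, dotProduct]
  rw [h2] at h1
  refine h1.trans (Finset.sum_congr rfl fun i _ => ?_)
  rw [variance_const_mul, variance_fun_id_gaussianReal]
  simp

lemma trace_mul_transpose_self (M : Matrix (Fin m) (Fin n) ℝ) :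
    (M * Mᵀ).trace = ∑ j, ∑ i, M j i ^ 2 := by
  simp [Matrix.trace, Matrix.mul_apply, sq]

lemma integrable_sum_sq_mulVec (M : Matrix (Fin m) (Fin n) ℝ) :
    Integrable (fun z => ∑ j, (M *ᵥ z) j ^ 2) (multiplierLaw n) :=
  integrable_finsetSum _ fun j _ => (memLp_mulVec M j).integrable_sq

lemma integral_sum_sq_mulVec (M : Matrix (Fin m) (Fin n) ℝ) :
    ∫ z, ∑ j, (M *ᵥ z) j ^ 2 ∂multiplierLaw n = (M * Mᵀ).trace := by
  rw [integral_finsetSum _ fun j _ => (memLp_mulVec M j).integrable_sq, trace_mul_transpose_self]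
  simp_rw [integral_sq_mulVec]

/-- The divergence of the Gaussian law `B Z` from the isotropic Gaussian law of variance `s`. -/
lemma hasDivergenceLE_gaussianImage_square {B : Matrix (Fin m) (Fin m) ℝ} (hB : B.det ≠ 0)
    {s : ℝ} (hs : 0 < s) (htr : (B * Bᵀ).trace ≤ m * s) :
    HasDivergenceLE (gaussianImage B) (gaussianImage (√s • (1 : Matrix (Fin m) (Fin m) ℝ)))
      (m / 2 * Real.log s - 1 / 2 * Real.log (B * Bᵀ).det) := by
  have hsq : 0 < √s := Real.sqrt_pos.2 hs
  set S : Matrix (Fin m) (Fin m) ℝ := √s • 1 with hSdef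
  have hSd : S.det = √s ^ m := by rw [hSdef, Matrix.det_smul, Matrix.det_one, Fintype.card_fin, mul_one]
  have hS0 : S.det ≠ 0 := by rw [hSd]; positivity
  have hSi : S⁻¹ = (√s)⁻¹ • (1 : Matrix (Fin m) (Fin m) ℝ) := by
    refine Matrix.inv_eq_left_inv ?_
    rw [hSdef, smul_mul_smul_comm, inv_mul_cancel₀ hsq.ne', one_smul, one_mul]
  have hpB := imageDensity_pos hB
  have hpS := imageDensity_pos hS0
  -- Pulled back along `y = B z`, the log ratio is a constant plus two quadratic forms. Writing `z`
  -- as `1 *ᵥ z` lets `integral_sum_sq_mulVec` evaluate both, the second to `m`.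
  have hlog : ∀ z, Real.log (imageDensity B (B *ᵥ z) / imageDensity S (B *ᵥ z)) =
      (m / 2 * Real.log s - 1 / 2 * Real.log (B * Bᵀ).det) +
        ((∑ j, (B *ᵥ z) j ^ 2) / (2 * s) - (∑ j, ((1 : Matrix (Fin m) (Fin m) ℝ) *ᵥ z) j ^ 2) / 2)
        := fun z => by
    rw [Real.log_div (hpB _).ne' (hpS _).ne', imageDensity, imageDensity,
      Real.log_mul (abs_pos.2 (inv_ne_zero hB)).ne' (stdDensity_pos _).ne',
      Real.log_mul (abs_pos.2 (inv_ne_zero hS0)).ne' (stdDensity_pos _).ne',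
      log_stdDensity, log_stdDensity, Matrix.mulVec_mulVec, Matrix.nonsing_inv_mul B hB.isUnit,
      hSi, hSd, Matrix.smul_mulVec, Matrix.one_mulVec, Matrix.one_mulVec, Real.log_abs,
      Real.log_abs, Matrix.det_mul, Matrix.det_transpose, Real.log_mul hB hB]
    simp only [Real.log_inv, Real.log_pow, Real.log_sqrt hs.le, Pi.smul_apply, smul_eq_mul, mul_pow, inv_pow, Real.sq_sqrt hs.le, ← Finset.mul_sum]
    field_simp
    ring
  have hm : Measurable fun y => imageDensity B y / imageDensity S y :=
    (measurable_imageDensity B).div (measurable_imageDensity S)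
  have hq : Integrable (fun z => (∑ j, (B *ᵥ z) j ^ 2) / (2 * s) -
      (∑ j, ((1 : Matrix (Fin m) (Fin m) ℝ) *ᵥ z) j ^ 2) / 2) (multiplierLaw m) :=
    ((integrable_sum_sq_mulVec B).div_const _).sub ((integrable_sum_sq_mulVec 1).div_const _)
  have hi : Integrable (fun z => Real.log (imageDensity B (B *ᵥ z) / imageDensity S (B *ᵥ z)))
      (multiplierLaw m) := by
    simp_rw [hlog]
    exact (integrable_const _).add hq
  refine ⟨fun y => imageDensity B y / imageDensity S y, hm,
    fun y => (div_pos (hpB y) (hpS y)).le, ?_, ?_, ?_⟩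
  · rw [gaussianImage_eq_withDensity hB, gaussianImage_eq_withDensity hS0,
      ← withDensity_mul _ (measurable_imageDensity S).ennreal_ofReal hm.ennreal_ofReal]
    congr 1
    funext y
    rw [Pi.mul_apply, ← ENNReal.ofReal_mul (hpS y).le, mul_div_cancel₀ _ (hpS y).ne']
  · exact (integrable_map_measure hm.log.aestronglyMeasurable
      (measurable_mulVec B).aemeasurable).2 hi
  · rw [gaussianImage, integral_map (measurable_mulVec B).aemeasurable
      hm.log.aestronglyMeasurable]
    simp_rw [hlog]
    rw [integral_add (integrable_const _) hq,
      integral_sub ((integrable_sum_sq_mulVec B).div_const _)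
      ((integrable_sum_sq_mulVec 1).div_const _), integral_div, integral_div,
      integral_sum_sq_mulVec, integral_sum_sq_mulVec]
    have : (B * Bᵀ).trace / (2 * s) ≤ m / 2 := by
      rw [div_le_div_iff₀ (by positivity) (by norm_num)]
      linarith
    simpa using this

open scoped MatrixOrder Matrix.Norms.L2Operator in
lemma exists_mul_transpose_eq {S : Matrix (Fin m) (Fin m) ℝ} (hS : S.PosSemidef) :
    ∃ B : Matrix (Fin m) (Fin m) ℝ, B * Bᵀ = S := by
  refine ⟨CFC.sqrt S, ?_⟩
  have h := (Matrix.nonneg_iff_posSemidef.1 (CFC.sqrt_nonneg S)).isHermitian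
  have h' : (CFC.sqrt S)ᵀ = CFC.sqrt S := by simpa [Matrix.IsHermitian] using h
  rw [h', CFC.sqrt_mul_sqrt_self S (Matrix.nonneg_iff_posSemidef.2 hS)]

/-- The law depends only on `M * Mᵀ`, so the rectangular `M` may be replaced by the square root of
its covariance, for which the density is explicit. -/
lemma hasDivergenceLE_gaussianImage {M : Matrix (Fin m) (Fin n) ℝ} (hM : (M * Mᵀ).det ≠ 0)
    {s : ℝ} (hs : 0 < s) (htr : (M * Mᵀ).trace ≤ m * s) :
    HasDivergenceLE (gaussianImage M) (gaussianImage (√s • (1 : Matrix (Fin m) (Fin m) ℝ)))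
      (m / 2 * Real.log s - 1 / 2 * Real.log (M * Mᵀ).det) := by
  have hpsd : (M * Mᵀ).PosSemidef := by
    simpa using Matrix.posSemidef_self_mul_conjTranspose M
  obtain ⟨B, hB⟩ := exists_mul_transpose_eq hpsd
  rw [gaussianImage_eq_of_mul_transpose_eq hB.symm, ← hB]
  refine hasDivergenceLE_gaussianImage_square (fun h => hM ?_) hs (hB ▸ htr)
  rw [← hB, Matrix.det_mul, h, zero_mul]

end Gaussian


/-! ### Output laws of the channel -/

section Masked

variable {m p : ℕ} (A : Matrix (Fin m) (Fin p) ℝ) (x : Fin p → Bool)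

/-- `A` with the columns outside the support of `x` replaced by zero. -/
def masked : Matrix (Fin m) (Fin p) ℝ := Matrix.of fun j i => if x i = true then A j i else 0

lemma output_eq_masked_mulVec (w : Fin p → ℝ) : output A x w = masked A x *ᵥ w := by
  funext j
  simp only [output, Matrix.mulVec, dotProduct]
  refine Finset.sum_congr rfl fun i _ => ?_
  by_cases h : x i = true <;> simp [masked, h]

lemma map_output_eq_gaussianImage :
    (multiplierLaw p).map (output A x) = gaussianImage (masked A x) := by
  rw [gaussianImage]
  congr 1
  funext w
  exact output_eq_masked_mulVec A x w

lemma measurable_output : Measurable (output A x) := by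
  have : output A x = fun w => masked A x *ᵥ w := funext fun w => output_eq_masked_mulVec A x w
  rw [this]
  exact measurable_mulVec _

lemma masked_mul_transpose : masked A x * (masked A x)ᵀ = colsAt A x * (colsAt A x)ᵀ := by
  ext j l
  simp only [Matrix.mul_apply, Matrix.transpose_apply, masked, Matrix.of_apply, colsAt,
    Matrix.submatrix_apply, id]
  rw [← Finset.sum_subtype (Finset.univ.filter fun i => x i = true) (by simp)
    (fun i => A j i * A l i), Finset.sum_filter]
  refine Finset.sum_congr rfl fun i _ => ?_
  by_cases h : x i = true <;> simp [h]

lemma trace_colsAt : (colsAt A x * (colsAt A x)ᵀ).trace =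
    ∑ i ∈ Finset.univ.filter (fun i => x i = true), colNormSq A i := by
  rw [← masked_mul_transpose, trace_mul_transpose_self, Finset.sum_comm, Finset.sum_filter]
  refine Finset.sum_congr rfl fun i _ => ?_
  by_cases h : x i = true <;> simp [masked, h, colNormSq]

variable {A}

lemma colNormSq_pos (hm : 1 ≤ m) (hA : FullyLinearlyIndependent A) (i : Fin p) :
    0 < colNormSq A i := by
  have h := (hA {i} (by simpa using hm)).ne_zero ⟨i, Finset.mem_singleton_self i⟩
  refine (Finset.sum_nonneg fun j _ => sq_nonneg (A j i)).lt_of_ne fun h0 => h ?_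
  funext j
  have := (Finset.sum_eq_zero_iff_of_nonneg fun j _ => sq_nonneg (A j i)).1 h0.symm j
    (Finset.mem_univ j)
  simpa [Matrix.col] using this

/-- Any `m` columns in the support of `x` form a basis, and a vector orthogonal to a basis is zero.
This makes the output covariance positive definite. -/
lemma vecMul_injective_colsAt (hA : FullyLinearlyIndependent A) {x : Fin p → Bool}
    (hx : m ≤ weight x) : Function.Injective (colsAt A x).vecMul := by
  obtain ⟨s, hs, hcard⟩ := Finset.exists_subset_card_eq hx
  have hli := hA s hcard.le
  have hspan : Submodule.span ℝ (Set.range fun i : s => A.col (i : Fin p)) = ⊤ := by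
    refine hli.span_eq_top_of_card_eq_finrank' ?_
    simp [hcard]
  rw [← Matrix.coe_vecMulLinear, ← LinearMap.ker_eq_bot, LinearMap.ker_eq_bot']
  intro v hv
  have hv' : ∀ i : s, v ⬝ᵥ A.col (i : Fin p) = 0 := fun i => by
    have hi : x i = true := (Finset.mem_filter.1 (hs i.2)).2
    exact congrFun hv ⟨i, hi⟩
  have hall : ∀ w ∈ Submodule.span ℝ (Set.range fun i : s => A.col (i : Fin p)), v ⬝ᵥ w = 0 := by
    intro w hw
    induction hw using Submodule.span_induction with
    | mem w h => obtain ⟨i, rfl⟩ := h; exact hv' i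
    | zero => simp
    | add a b _ _ ha hb => rw [dotProduct_add, ha, hb, add_zero]
    | smul c a _ ha => rw [dotProduct_smul, ha, smul_zero]
  exact dotProduct_self_eq_zero.1 (hall v (hspan ▸ Submodule.mem_top))

lemma det_colsAt_pos (hA : FullyLinearlyIndependent A) {x : Fin p → Bool} (hx : m ≤ weight x) :
    0 < (colsAt A x * (colsAt A x)ᵀ).det := by
  have := (Matrix.PosDef.mul_conjTranspose_self _ (vecMul_injective_colsAt hA hx)).det_pos
  simpa using this

/-- The divergence of an output law of full rank from an isotropic Gaussian law. -/
lemma hasDivergenceLE_output (hA : FullyLinearlyIndependent A) {x : Fin p → Bool}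
    (hx : m ≤ weight x) {a s : ℝ} (ha : ∀ i, colNormSq A i ≤ a) (hs : 0 < s)
    (hsa : weight x * a ≤ m * s) :
    HasDivergenceLE ((multiplierLaw p).map (output A x))
      (gaussianImage (√s • (1 : Matrix (Fin m) (Fin m) ℝ)))
      (m / 2 * Real.log s - 1 / 2 * Real.log (colsAt A x * (colsAt A x)ᵀ).det) := by
  rw [map_output_eq_gaussianImage, ← masked_mul_transpose]
  refine hasDivergenceLE_gaussianImage ?_ hs ?_
  · rw [masked_mul_transpose]
    exact (det_colsAt_pos hA hx).ne'
  · rw [masked_mul_transpose, trace_colsAt]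
    refine le_trans ?_ hsa
    have := Finset.sum_le_card_nsmul (Finset.univ.filter fun i => x i = true) (colNormSq A) a
      fun i _ => ha i
    simpa [weight] using this

/-- Both entropies in `cTilde` contain `m / 2 * log (2πe)`, which cancels. -/
lemma le_cTilde {k : ℕ} (hm : 1 ≤ m) (hk : 1 ≤ k) {i : Fin p} (hi : 0 < colNormSq A i)
    {x : Fin p → Bool} (hx : weight x = k) (hd : 0 < (colsAt A x * (colsAt A x)ᵀ).det) :
    m / 2 * Real.log ((k : ℝ) / m * colNormSq A i) -
      1 / 2 * Real.log (colsAt A x * (colsAt A x)ᵀ).det ≤ cTilde A k := by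
  have hm0 : (0 : ℝ) < m := by exact_mod_cast hm
  have hk0 : (0 : ℝ) < k := by exact_mod_cast hk
  have hc : 0 < 2 * Real.pi * Real.exp 1 := by positivity
  have h1 := le_ciSup (Set.finite_range fun i : Fin p => (m : ℝ) / 2 *
      Real.log (2 * Real.pi * Real.exp 1 * ((k : ℝ) / (m : ℝ)) * colNormSq A i)).bddAbove i
  have h2 := ciInf_le (Set.finite_range fun x : weightClass p k => 1 / 2 *
      Real.log ((2 * Real.pi * Real.exp 1) ^ m *
        (colsAt A (x : Fin p → Bool) * (colsAt A (x : Fin p → Bool)).transpose).det)).bddBelow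
      ⟨x, hx⟩
  simp only at h1 h2
  rw [mul_assoc, Real.log_mul hc.ne' (by positivity)] at h1
  rw [Real.log_mul (pow_pos hc m).ne' hd.ne', Real.log_pow] at h2
  unfold cTilde
  linarith

end Masked

/-! ### Counting binary vectors of small weight -/

lemma weight_le {p : ℕ} (x : Fin p → Bool) : weight x ≤ p := by
  simpa [weight] using Finset.card_filter_le (Finset.univ : Finset (Fin p)) (fun i => x i = true)

lemma eq_true_of_weight_eq {p : ℕ} {x : Fin p → Bool} (h : weight x = p) : x = fun _ => true := by
  have h' : (Finset.univ.filter fun i => x i = true).card = (Finset.univ : Finset (Fin p)).card := by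
    simpa [weight] using h
  funext i
  exact Finset.card_filter_eq_iff.1 h' i (Finset.mem_univ i)

lemma eq_false_of_weight_eq_zero {p : ℕ} {x : Fin p → Bool} (h : weight x = 0) :
    x = fun _ => false := by
  funext i
  have := Finset.filter_eq_empty_iff.1 (Finset.card_eq_zero.1 h) (Finset.mem_univ i)
  simpa using this

lemma card_weight_lt_le (m p : ℕ) :
    Fintype.card {x : Fin p → Bool // weight x < m} ≤ ∑ k ∈ Finset.range m, p.choose k := by
  calc Fintype.card {x : Fin p → Bool // weight x < m}
      ≤ ((Finset.range m).biUnion fun k => (Finset.univ : Finset (Fin p)).powersetCard k).card := by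
        rw [← Finset.card_univ]
        refine Finset.card_le_card_of_injOn
          (fun x => Finset.univ.filter fun i => (x : Fin p → Bool) i = true) ?_ ?_
        · intro x _
          simpa [weight] using x.2
        · intro x _ y _ h
          refine Subtype.ext (funext fun i => ?_)
          have := Finset.ext_iff.1 h i
          simp only [Finset.mem_filter, Finset.mem_univ, true_and] at this
          exact Bool.eq_iff_iff.2 this
    _ ≤ ∑ k ∈ Finset.range m, p.choose k := by
        refine Finset.card_biUnion_le.trans (Finset.sum_le_sum fun k _ => ?_)
        simp

lemma choose_le_choose_of_two_mul_le {p r k : ℕ} (hkr : k ≤ r) (hr : 2 * r ≤ p + 1) :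
    p.choose k ≤ p.choose r := by
  induction r, hkr using Nat.le_induction with
  | base => exact le_rfl
  | succ r _ ih =>
    refine (ih (by omega)).trans ?_
    rcases lt_or_ge r (p / 2) with h | h
    · exact Nat.choose_le_succ_of_lt_half_left h
    -- The borderline step: the two central binomial coefficients of an odd row are equal.
    · obtain rfl : p = 2 * r + 1 := by omega
      rw [Nat.choose_symm_half]

/-- Each term with `1 ≤ k < m` is at most `C(p, m-1)`. The term `k = 0` and the extra `1` add up to
`2 ≤ p ≤ C(p, m-1)`; the last inequality needs `m ≥ 2`. -/
lemma sum_choose_add_one_le {m p : ℕ} (hm : 2 ≤ m) (hp : 3 ≤ p) (hmp : 2 * (m - 1) ≤ p + 1) :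
    ∑ k ∈ Finset.range m, p.choose k + 1 ≤ m * p.choose (m - 1) := by
  obtain ⟨r, rfl⟩ : ∃ r, m = r + 1 := ⟨m - 1, by omega⟩
  simp only [Nat.add_sub_cancel] at hmp ⊢
  rw [Finset.sum_range_succ']
  have h1 : ∑ k ∈ Finset.range r, p.choose (k + 1) ≤ r * p.choose r := by
    have := Finset.sum_le_card_nsmul (Finset.range r) (fun k => p.choose (k + 1)) (p.choose r)
      fun k hk => choose_le_choose_of_two_mul_le (Finset.mem_range.1 hk) hmp
    simpa using this
  have h2 : p ≤ p.choose r := by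
    simpa using choose_le_choose_of_two_mul_le (k := 1) (by omega) hmp
  rw [Nat.choose_zero_right, add_mul]
  omega

/-! ### The covers and the resulting capacity bounds -/

section Capacity

variable {m p : ℕ} {A : Matrix (Fin m) (Fin p) ℝ}

lemma exists_isMax_colNormSq (hp : 1 ≤ p) (A : Matrix (Fin m) (Fin p) ℝ) :
    ∃ i₀, ∀ i, colNormSq A i ≤ colNormSq A i₀ := by
  have : Nonempty (Fin p) := ⟨⟨0, hp⟩⟩
  exact Finite.exists_max (colNormSq A)

theorem capacity_le_of_one_lt (hm : 2 ≤ m) (hp : 3 ≤ p) (hmp : 2 * (m - 1) ≤ p + 1)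
    (hA : FullyLinearlyIndependent A) {L : ℝ} (hL1 : Real.log (p.choose (m - 1) : ℝ) ≤ L)
    (hL2 : ∀ k, m ≤ k → k ≤ p → cTilde A k ≤ L) :
    ∃ C : NNReal, IsGreatest (Set.range fun P : PMF (Fin p → Bool) => channelInfo A P)
      (C : ENNReal) ∧ (C : ℝ) ≤ Real.log (p * Real.exp L) := by
  have hm1 : 1 ≤ m := by omega
  have hm0 : (0 : ℝ) < m := by exact_mod_cast hm1
  obtain ⟨i₀, hi₀⟩ := exists_isMax_colNormSq (by omega) A
  have ha := colNormSq_pos hm1 hA i₀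
  have hC0 : 0 < p.choose (m - 1) := Nat.choose_pos (by omega)
  have hC : (p.choose (m - 1) : ℝ) ≤ Real.exp L :=
    (Real.log_le_iff_le_exp (by exact_mod_cast hC0)).1 hL1
  have hC1 : (1 : ℝ) ≤ p.choose (m - 1) := by exact_mod_cast hC0
  have hQ : ∀ x, IsProbabilityMeasure ((multiplierLaw p).map (output A x)) := fun x =>
    Measure.isProbabilityMeasure_map (measurable_output A x).aemeasurable
  -- The index `k : Fin (p - m)` stands for weight `m + k < p`. Full weight is a single input, so
  -- covering it by its own law costs `1` rather than `exp L`.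
  let T : {x : Fin p → Bool // weight x < m} ⊕ Fin (p - m) ⊕ Unit → Measure (Fin m → ℝ) :=
    Sum.elim (fun x => (multiplierLaw p).map (output A x)) (Sum.elim
      (fun k => gaussianImage
        (√(((m + k : ℕ) : ℝ) / m * colNormSq A i₀) • (1 : Matrix (Fin m) (Fin m) ℝ)))
      (fun _ => (multiplierLaw p).map (output A fun _ => true)))
  have hT : ∀ j, IsProbabilityMeasure (T j) := by
    rintro (x | k | _)
    · exact hQ x
    · exact inferInstanceAs (IsProbabilityMeasure (gaussianImage _))
    · exact hQ _
  refine exists_isGreatest_mutualInfo_of_cover (measurable_output A) T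
    (Sum.elim (fun _ => 1) (Sum.elim (fun _ => Real.exp L) fun _ => 1)) ?_ ?_ ?_ ?_
  · rintro (x | k | _)
    · exact zero_lt_one
    · exact Real.exp_pos L
    · exact zero_lt_one
  · intro x
    rcases lt_or_ge (weight x) m with hx | hx
    · refine ⟨Sum.inl ⟨x, hx⟩, (HasDivergenceLE.refl _).mono_right ?_⟩
      simp
    rcases (weight_le x).lt_or_eq with hxp | hxp
    · refine ⟨Sum.inr (Sum.inl ⟨weight x - m, by omega⟩), ?_⟩
      have hk : m + (weight x - m) = weight x := by omega
      have hk1 : 1 ≤ weight x := hm1.trans hx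
      have hk0 : (0 : ℝ) < weight x := by exact_mod_cast hk1
      simp only [Sum.elim_inr, Sum.elim_inl, Real.log_exp, T, hk]
      refine (hasDivergenceLE_output hA hx hi₀ (by positivity) ?_).mono_right
        ((le_cTilde hm1 hk1 ha rfl (det_colsAt_pos hA hx)).trans (hL2 _ hx (weight_le x)))
      rw [← mul_assoc, mul_div_cancel₀ _ hm0.ne']
    · refine ⟨Sum.inr (Sum.inr ()), ?_⟩
      rw [eq_true_of_weight_eq hxp]
      refine (HasDivergenceLE.refl _).mono_right ?_
      simp
  · have h1 : (Fintype.card {x : Fin p → Bool // weight x < m} : ℝ) + 1 ≤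
        m * p.choose (m - 1) := by
      exact_mod_cast (Nat.add_le_add_right (card_weight_lt_le m p) 1).trans
        (sum_choose_add_one_le hm hp hmp)
    have h2 : (m : ℝ) * p.choose (m - 1) ≤ m * Real.exp L := mul_le_mul_of_nonneg_left hC hm0.le
    have h3 : ((p - m : ℕ) : ℝ) = p - m := Nat.cast_sub (by omega)
    simp only [Fintype.sum_sum_type, Sum.elim_inl, Sum.elim_inr, Finset.sum_const,
      Finset.card_univ, nsmul_eq_mul, Fintype.card_fin, h3, mul_one, Fintype.card_unit,
      Nat.cast_one]
    linarith
  · have : (1 : ℝ) ≤ p := by exact_mod_cast (by omega : 1 ≤ p)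
    nlinarith

/-- A scalar Gaussian of variance `p * max ‖A(i)‖²` covers every nonzero input. The factor `p` costs
`(1/2) log p` beyond `c̃(1)`, so the total weight is `1 + √p * exp L`. -/
theorem capacity_le_of_one {A : Matrix (Fin 1) (Fin p) ℝ} (hp : 3 ≤ p)
    (hA : FullyLinearlyIndependent A) {L : ℝ} (hL0 : 0 ≤ L) (hL : cTilde A 1 ≤ L) :
    ∃ C : NNReal, IsGreatest (Set.range fun P : PMF (Fin p → Bool) => channelInfo A P)
      (C : ENNReal) ∧ (C : ℝ) ≤ Real.log (p * Real.exp L) := by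
  obtain ⟨i₀, hi₀⟩ := exists_isMax_colNormSq (by omega) A
  have ha := colNormSq_pos le_rfl hA i₀
  have hp3 : (3 : ℝ) ≤ p := by exact_mod_cast hp
  have hp0 : (0 : ℝ) < p := by linarith
  have hM : 1 ≤ Real.exp L := Real.one_le_exp hL0
  have hQ : ∀ x, IsProbabilityMeasure ((multiplierLaw p).map (output A x)) := fun x =>
    Measure.isProbabilityMeasure_map (measurable_output A x).aemeasurable
  let T : Unit ⊕ Unit → Measure (Fin 1 → ℝ) :=
    Sum.elim (fun _ => (multiplierLaw p).map (output A fun _ => false))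
      (fun _ => gaussianImage (√(p * colNormSq A i₀) • (1 : Matrix (Fin 1) (Fin 1) ℝ)))
  have hT : ∀ j, IsProbabilityMeasure (T j) := by
    rintro (_ | _)
    · exact hQ _
    · exact inferInstanceAs (IsProbabilityMeasure (gaussianImage _))
  refine exists_isGreatest_mutualInfo_of_cover (measurable_output A) T
    (Sum.elim (fun _ => 1) fun _ => √p * Real.exp L) ?_ ?_ ?_ ?_
  · rintro (_ | _)
    · exact zero_lt_one
    · exact mul_pos (Real.sqrt_pos.2 hp0) (Real.exp_pos L)
  · intro x
    rcases Nat.eq_zero_or_pos (weight x) with hx | hx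
    · refine ⟨Sum.inl (), ?_⟩
      rw [eq_false_of_weight_eq_zero hx]
      refine (HasDivergenceLE.refl _).mono_right ?_
      simp
    · refine ⟨Sum.inr (), ?_⟩
      obtain ⟨i, hi⟩ := Finset.card_pos.1 hx
      -- In dimension one the determinant is a sum of squared column norms, so it is at least its
      -- value at a single active column. This reduces every weight to `c̃(1)`.
      set e : Fin p → Bool := fun j => decide (j = i) with he
      have hfil : (Finset.univ.filter fun j => e j = true) = {i} := by
        ext j
        simp [he]
      have hew : weight e = 1 := by
        rw [weight, hfil, Finset.card_singleton]
      have hde := det_colsAt_pos hA (x := e) hew.ge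
      have htr : ∀ S : Matrix (Fin 1) (Fin 1) ℝ, S.det = S.trace := fun S => by
        simp [Matrix.trace]
      have hle : (colsAt A e * (colsAt A e)ᵀ).det ≤ (colsAt A x * (colsAt A x)ᵀ).det := by
        rw [htr, htr, trace_colsAt, trace_colsAt, hfil, Finset.sum_singleton]
        exact Finset.single_le_sum (f := colNormSq A)
          (fun j _ => (colNormSq_pos le_rfl hA j).le) hi
      have hlog := Real.log_le_log hde hle
      have hc := le_cTilde le_rfl le_rfl ha hew hde
      refine (hasDivergenceLE_output hA hx hi₀ (mul_pos hp0 ha) ?_).mono_right ?_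
      · have : (weight x : ℝ) ≤ p := by exact_mod_cast weight_le x
        have := mul_le_mul_of_nonneg_right this ha.le
        simpa using this
      · simp only [Sum.elim_inr]
        rw [Real.log_mul hp0.ne' ha.ne', Real.log_mul (Real.sqrt_pos.2 hp0).ne'
          (Real.exp_pos L).ne', Real.log_exp, Real.log_sqrt hp0.le]
        simp only [Nat.cast_one, div_one, one_mul] at hc ⊢
        linarith
  -- With `1 ≤ exp L`, this gives `1 + √p * exp L ≤ p * exp L`; `p = 2` would fail.
  · have hs : √(p : ℝ) ≤ p - 1 := Real.sqrt_le_iff.2 ⟨by linarith, by nlinarith⟩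
    simp only [Fintype.sum_sum_type, Sum.elim_inl, Sum.elim_inr, Finset.univ_unique,
      Finset.sum_singleton]
    nlinarith
  · nlinarith

end Capacity

end SparseChannel

theorem mainTheorem4 (m p : ℕ) (hm : 1 ≤ m) (hp : 3 ≤ p) (hmp : 2 * (m - 1 : ℤ) ≤ p + 1)
    (A : Matrix (Fin m) (Fin p) ℝ) (hA : SparseChannel.FullyLinearlyIndependent A) :
    ∃ C : NNReal,
      IsGreatest (Set.range fun P : PMF (Fin p → Bool) => SparseChannel.channelInfo A P)
        (C : ENNReal) ∧
      (C : ℝ) ≤ max (Real.log (p.choose (m - 1) : ℝ))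
          (⨆ k : Set.Icc m p, SparseChannel.cTilde A (k : ℕ)) + Real.log (p : ℝ) := by
  set L := max (Real.log (p.choose (m - 1) : ℝ))
    (⨆ k : Set.Icc m p, SparseChannel.cTilde A (k : ℕ)) with hL
  have hp0 : (p : ℝ) ≠ 0 := by
    exact_mod_cast (by omega : p ≠ 0)
  have hlog : Real.log (p * Real.exp L) = L + Real.log p := by
    rw [Real.log_mul hp0 (Real.exp_pos L).ne', Real.log_exp, add_comm]
  have hsup : ∀ k, m ≤ k → k ≤ p → SparseChannel.cTilde A k ≤ L := fun k h1 h2 =>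
    (le_ciSup (f := fun k : Set.Icc m p => SparseChannel.cTilde A (k : ℕ))
      (Set.finite_range _).bddAbove ⟨k, h1, h2⟩).trans (le_max_right _ _)
  rw [← hlog]
  rcases hm.eq_or_lt with rfl | hm2
  · refine SparseChannel.capacity_le_of_one hp hA ?_ (hsup 1 le_rfl (by omega))
    -- For `m = 1` the binomial is `C(p, 0) = 1`, so the first entry of the maximum is `0`.
    refine le_trans ?_ (le_max_left _ _)
    simp
  · exact SparseChannel.capacity_le_of_one_lt hm2 hp (by omega) hA (le_max_left _ _) hsup
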